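/- A size pair $(\mathcal M,\vec\varphi)$ consists of a non-empty compact, locally connected Hausdorff space $\mathcal M$ and a continuous function $\vec\varphi=(\varphi_1,\dots,\varphi_k):\mathcal M\to\mathbb R^k$, $k\ge 1$. For $\vec x\in\mathbb R^k$ put $\mathcal M\langle\vec\varphi\preceq\vec x\rangle=\{P\in\mathcal M:\varphi_i(P)\le x_i,\ i=1,\dots,k\}$. The size function $\ell_{(\mathcal M,\vec\varphi)}$ is defined on $\Delta^+=\{(\vec x,\vec y)\in\mathbb R^k\times\mathbb R^k: x_i<y_i \text{ for all } i\}$: its value $\ell_{(\mathcal M,\vec\varphi)}(\vec x,\vec y)$ is the number of equivalence classes into which $\mathcal M\langle\vec\varphi\preceq\vec x\rangle$ is divided by the relation "$P$ and $Q$ lie in a common connected subset of $\mathcal M\langle\vec\varphi\preceq\vec y\rangle$". A pair $(\vec l,\vec b)\in\mathbb R^k\times\mathbb R^k$ is admissible if $\sum_i l_i^2=1$, $l_i>0$ for every $i$, and $\sum_i b_i=0$. For such a pair let $$F^{\vec\varphi}_{(\vec l,\vec b)}(P)=\max_{i=1,\dots,k}\frac{\varphi_i(P)-b_i}{l_i},\qquad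 P\in\mathcal M .$$ For a size function $\ell$ with $k=1$, the multiplicity of a point $(x,y)$ with $x<y$ is the minimum, over $\varepsilon>0$ with $x+\varepsilon<y-\varepsilon$, of $$\ell(x+\varepsilon,y-\varepsilon)-\ell(x-\varepsilon,y-\varepsilon)-\ell(x+\varepsilon,y+\varepsilon)+\ell(x-\varepsilon,y+\varepsilon),$$ and the multiplicity of $(x,\infty)$ is the minimum, over $\varepsilon>0$ with $x+\varepsilon<1/\varepsilon$, of $\ell(x+\varepsilon,1/\varepsilon)-\ell(x-\varepsilon,1/\varepsilon)$. Let $C_\ell$ be the multiset of all points $(x,y)$, $x<y\le\infty$, of positive multiplicity (the cornerpoints), counted with multiplicity, together with all points $(x,x)$, $x\in\mathbb R$, each counted countably infinitely often. The matching distance is $$d_{match}(\ell_1,\ell_2)=\inf_\sigma\sup_{p\in C_{\ell_1}}\delta(p,\sigma(p))\in[0,\infty],$$ where $\sigma$ ranges over all bijections $C_{\ell_1}\to C_{\ell_2}$ and $$\delta\big((x,y),(x',y')\big)=\min\Big\{\max\{|x-x'|,|y-y'|\},\ \max\big\{\tfrac{y-x}2,\tfrac{y'-x'}2\big\}\Big\},$$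 with the conventions $\infty-\infty=0$, $|\infty-c|=|c-\infty|=\infty$ for real $c$, and $\infty/2=\infty$. **Corollary.** Let $(\mathcal M,\vec\varphi)$ and $(\mathcal N,\vec\psi)$ be size pairs with the same $k\ge1$. Then $\ell_{(\mathcal M,\vec\varphi)}(\vec x,\vec y)=\ell_{(\mathcal N,\vec\psi)}(\vec x,\vec y)$ for all $(\vec x,\vec y)\in\Delta^+$ if and only if $$d_{match}\big(\ell_{(\mathcal M,F^{\vec\varphi}_{(\vec l,\vec b)})},\ \ell_{(\mathcal N,F^{\vec\psi}_{(\vec l,\vec b)})}\big)=0\quad\text{for every admissible pair }(\vec l,\vec b).$$ -/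

import Mathlib

open scoped ENNReal

namespace SizeTheory

section SizeFunctions

variable {X : Type*} {E : Type*} [Preorder E]

/-- The lower level set `M⟨φ ≤ x⟩`. With `E = Fin k → ℝ` the order is the componentwise one
(a `k`-dimensional measuring function), with `E = ℝ` it is the usual one. -/
def sublevel (φ : X → E) (x : E) : Set X := {P | φ P ≤ x}

variable [TopologicalSpace X]

/-- `P` and `Q` are `⟨φ ≤ y⟩`-connected: some connected subset of `M⟨φ ≤ y⟩` contains both. -/
def LevelConnected (φ : X → E) (y : E) (P Q : X) : Prop :=
  ∃ C : Set X, C ⊆ sublevel φ y ∧ IsConnected C ∧ P ∈ C ∧ Q ∈ C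

/-- The classes into which `M⟨φ ≤ x⟩` is divided by `⟨φ ≤ y⟩`-connectedness. -/
def levelClasses (φ : X → E) (x y : E) : Set (Set X) :=
  {S | ∃ P ∈ sublevel φ x, S = {Q | Q ∈ sublevel φ x ∧ LevelConnected φ y P Q}}

/-- The size function of `(X, φ)`: the number of classes of `M⟨φ ≤ x⟩` under
`⟨φ ≤ y⟩`-connectedness. It is only ever used at points `(x, y)` of the open region `Δ⁺`
(all coordinates of `x` strictly below those of `y`), where the number is finite
(see `levelClasses_finite_pi` and `levelClasses_finite_real`). -/
noncomputable def sizeFunction (φ : X → E) (x y : E) : ℕ := (levelClasses φ x y).ncard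

/-- On `M⟨φ ≤ x⟩` with `x ≤ y`, being `⟨φ ≤ y⟩`-connected is an equivalence relation. -/
theorem levelConnected_equivalence (φ : X → E) {x y : E} (hxy : x ≤ y) :
    Equivalence (fun P Q : sublevel φ x => LevelConnected φ y P.1 Q.1) where
  refl P := ⟨{P.1}, Set.singleton_subset_iff.2 (le_trans P.2 hxy), isConnected_singleton,
    rfl, rfl⟩
  symm := fun ⟨C, h1, h2, h3, h4⟩ => ⟨C, h1, h2, h4, h3⟩
  trans := fun ⟨C, h1, h2, h3, h4⟩ ⟨D, k1, k2, k3, k4⟩ =>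
    ⟨C ∪ D, Set.union_subset h1 k1, IsConnected.union ⟨_, h4, k3⟩ h2 k2, Or.inl h3, Or.inr k4⟩

theorem levelClasses_finite [CompactSpace X] [LocallyConnectedSpace X] (φ : X → E) {x y : E}
    (hx : IsClosed (sublevel φ x)) (hxy : sublevel φ x ⊆ interior (sublevel φ y)) :
    (levelClasses φ x y).Finite := by
  have hloc : ∀ P ∈ sublevel φ x, ∃ V : Set X, V ⊆ interior (sublevel φ y) ∧ IsOpen V ∧
      P ∈ V ∧ IsConnected V := fun P hP =>
    locallyConnectedSpace_iff_subsets_isOpen_isConnected.1 inferInstance P _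
      (isOpen_interior.mem_nhds (hxy hP))
  choose! V hVs hVo hVP hVc using hloc
  obtain ⟨t, hcov⟩ := hx.isCompact.elim_nhds_subcover' (fun P _ => V P)
    (fun P hP => (hVo P hP).mem_nhds (hVP P hP))
  refine (t.finite_toSet.image fun P => {Q | Q ∈ sublevel φ x ∧ LevelConnected φ y P.1 Q}).subset ?_
  rintro S ⟨P, hP, rfl⟩
  obtain ⟨R, hR, hPR⟩ := Set.mem_iUnion₂.1 (hcov hP)
  have hRP : LevelConnected φ y R.1 P :=
    ⟨V R.1, (hVs _ R.2).trans interior_subset, hVc _ R.2, hVP _ R.2, hPR⟩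
  refine ⟨R, hR, Set.ext fun Q => and_congr_right fun _ => ⟨?_, ?_⟩⟩
  · rintro ⟨C, h1, h2, h3, h4⟩
    obtain ⟨D, k1, k2, k3, k4⟩ := hRP
    exact ⟨C ∪ D, Set.union_subset h1 k1, IsConnected.union ⟨_, h3, k3⟩ h2 k2, Or.inr k4,
      Or.inl h4⟩
  · rintro ⟨C, h1, h2, h3, h4⟩
    obtain ⟨D, k1, k2, k3, k4⟩ := hRP
    exact ⟨C ∪ D, Set.union_subset h1 k1, IsConnected.union ⟨_, h3, k4⟩ h2 k2, Or.inr k3,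
      Or.inl h4⟩

theorem levelClasses_finite_pi [CompactSpace X] [LocallyConnectedSpace X] {k : ℕ}
    {φ : X → Fin k → ℝ} (hφ : Continuous φ) {x y : Fin k → ℝ} (hxy : ∀ i, x i < y i) :
    (levelClasses φ x y).Finite := by
  refine levelClasses_finite φ (isClosed_Iic.preimage hφ) fun P hP => ?_
  have ho : IsOpen {Q | ∀ i, φ Q i < y i} := by
    simp only [Set.ofPred_forall]
    exact isOpen_iInter_of_finite fun i =>
      isOpen_lt ((continuous_apply i).comp hφ) continuous_const
  exact interior_maximal (fun Q hQ i => (hQ i).le) ho fun i => (hP i).trans_lt (hxy i)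

theorem levelClasses_finite_real [CompactSpace X] [LocallyConnectedSpace X]
    {φ : X → ℝ} (hφ : Continuous φ) {x y : ℝ} (hxy : x < y) :
    (levelClasses φ x y).Finite :=
  levelClasses_finite φ (isClosed_Iic.preimage hφ) fun _ hP =>
    interior_maximal (fun _ hQ => le_of_lt hQ) (isOpen_Iio.preimage hφ) (lt_of_le_of_lt hP hxy)

end SizeFunctions

section Foliation

/-- `(l, b)` is admissible: `l` is a (Euclidean) unit vector with positive coordinates, and the
coordinates of `b` sum to zero. -/
def Admissible {k : ℕ} (l b : Fin k → ℝ) : Prop :=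
  (∑ i, l i ^ 2 = 1) ∧ (∀ i, 0 < l i) ∧ ∑ i, b i = 0

/-- The function `F(P) = max_i (φ_i(P) - b_i) / l_i`; the supremum is a maximum over the
finite index set `Fin k`, which is non-empty where this is used. -/
noncomputable def foliationFunction {X : Type*} {k : ℕ} (φ : X → Fin k → ℝ) (l b : Fin k → ℝ)
    (P : X) : ℝ :=
  ⨆ i, (φ P i - b i) / l i

end Foliation

section MatchingDistance

/-- Points of the extended plane: `proper x y` is `(x, y)`, `atInfinity k` is `(k, ∞)`, which
stands for the vertical line `x = k`. -/
inductive ExtPoint : Type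
  | proper (x y : ℝ)
  | atInfinity (k : ℝ)

/-- The multiplicity of `(x, y)`, `x < y`: the minimum, over `ε > 0` with `x + ε < y - ε`, of
`ℓ(x+ε, y-ε) - ℓ(x-ε, y-ε) - ℓ(x+ε, y+ε) + ℓ(x-ε, y+ε)`. For a size function these integers are
non-negative. -/
noncomputable def properMult (ℓ : ℝ → ℝ → ℕ) (x y : ℝ) : ℕ :=
  sInf {n : ℕ | ∃ ε : ℝ, 0 < ε ∧ x + ε < y - ε ∧
    (n : ℤ) = ℓ (x + ε) (y - ε) - ℓ (x - ε) (y - ε) - ℓ (x + ε) (y + ε) + ℓ (x - ε) (y + ε)}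

/-- The multiplicity of the vertical line `x = k`, that is of `(k, ∞)`: the minimum, over `ε > 0`
with `k + ε < 1/ε`, of `ℓ(k+ε, 1/ε) - ℓ(k-ε, 1/ε)`. -/
noncomputable def infinityMult (ℓ : ℝ → ℝ → ℕ) (k : ℝ) : ℕ :=
  sInf {n : ℕ | ∃ ε : ℝ, 0 < ε ∧ k + ε < 1 / ε ∧
    (n : ℤ) = ℓ (k + ε) (1 / ε) - ℓ (k - ε) (1 / ε)}

open Classical in
/-- Multiplicities in the multiset of cornerpoints of `ℓ`, augmented by the points of the diagonal
with (countably) infinite multiplicity. A cornerpoint is a point, proper or at infinity, with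
positive multiplicity. -/
noncomputable def mult (ℓ : ℝ → ℝ → ℕ) : ExtPoint → ℕ∞
  | .proper x y => if x < y then (properMult ℓ x y : ℕ∞) else if x = y then ⊤ else 0
  | .atInfinity k => (infinityMult ℓ k : ℕ∞)

/-- The augmented multiset of cornerpoints, as the type of its elements: the point `p` occurs
in `mult ℓ p` copies. -/
def Diagram (ℓ : ℝ → ℝ → ℕ) : Type :=
  Σ p : ExtPoint, {n : ℕ // (n : ℕ∞) < mult ℓ p}

/-- The pseudo-distance `min (max |x-x'| |y-y'|) (max ((y-x)/2) ((y'-x')/2))`, extended to points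
at infinity by the conventions `∞ - ∞ = 0`, `∞ - y = ∞`, `∞ / 2 = ∞`. -/
noncomputable def pointCost : ExtPoint → ExtPoint → ℝ≥0∞
  | .proper x y, .proper x' y' =>
      ENNReal.ofReal (min (max |x - x'| |y - y'|) (max ((y - x) / 2) ((y' - x') / 2)))
  | .atInfinity k, .atInfinity k' => ENNReal.ofReal |k - k'|
  | .proper _ _, .atInfinity _ => ⊤
  | .atInfinity _, .proper _ _ => ⊤

/-- The matching distance between 1-dimensional size functions: the infimum, over all bijections
between the augmented multisets of cornerpoints, of the largest displacement. It may be `∞`.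
It depends only on the values `ℓ x y` with `x < y`. -/
noncomputable def matchingDist (ℓ₁ ℓ₂ : ℝ → ℝ → ℕ) : ℝ≥0∞ :=
  ⨅ σ : Diagram ℓ₁ ≃ Diagram ℓ₂, ⨆ c : Diagram ℓ₁, pointCost c.1 (σ c).1

end MatchingDistance

end SizeTheory

namespace SizeTheory

/-! ### Connected components of sublevel sets -/

section Sublevel

variable {X : Type*} [TopologicalSpace X]

/-! Every point of `Δ⁺` has the form `(s l + b, t l + b)` with `(l, b)` admissible and `s < t`, and
the sublevel set of the foliation function at `s` is that of `φ` at `s l + b`. So the size function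
of `φ` on one leaf is a one-dimensional size function, and it remains to show that two
one-dimensional size functions agree on `s < t` exactly when their matching distance vanishes.

If they agree, all multiplicities agree and the identity matching costs nothing. For the converse,
`ℓ(s, t)` is the number of cornerpoints `(x, y)`, `y ≤ ∞`, with `x ≤ s` and `y > t`
(`RankFunction.nonempty_fin_equiv_upperLeft`). A matching of cost below a small `ε` sends the
cornerpoints counted at `(s, t')` injectively to points counted at `(s + ε, t' - ε)`.
Right-continuity of size functions in each variable absorbs the shift, giving `ℓ₁ ≤ ℓ₂`, and
symmetry gives equality. No optimal matching is needed.

The count is obtained by summing jumps twice: `ℓ(·, t)` is the sum of its left jumps, and each left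
jump, as a function of the level, decreases by the multiplicities of proper cornerpoints until it
stabilises at the multiplicity at infinity. The topology enters only through the properties in
`RankFunction`. -/

theorem levelConnected_iff {E : Type*} [Preorder E] {φ : X → E} {y : E} {P Q : X}
    (hP : P ∈ sublevel φ y) :
    LevelConnected φ y P Q ↔ Q ∈ connectedComponentIn (sublevel φ y) P := by
  constructor
  · rintro ⟨C, hC, hconn, hPC, hQC⟩
    exact hconn.isPreconnected.subset_connectedComponentIn hPC hC hQC
  · intro h
    exact ⟨_, connectedComponentIn_subset _ _, isConnected_connectedComponentIn_iff.2 hP,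
      mem_connectedComponentIn hP, h⟩

theorem sublevel_mono {X E : Type*} [Preorder E] (φ : X → E) {x y : E} (h : x ≤ y) :
    sublevel φ x ⊆ sublevel φ y := fun _ hP => le_trans hP h

/-- The size function counts the components of `M⟨φ ≤ y⟩` that meet `M⟨φ ≤ x⟩`. -/
theorem sizeFunction_eq_ncard {E : Type*} [Preorder E] (φ : X → E) {x y : E} (hxy : x ≤ y) :
    sizeFunction φ x y =
      (connectedComponentIn (sublevel φ y) '' sublevel φ x).ncard := by
  have hsub := sublevel_mono φ hxy
  have hcl : levelClasses φ x y =
      (fun C => sublevel φ x ∩ C) '' (connectedComponentIn (sublevel φ y) '' sublevel φ x) := by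
    rw [Set.image_image]
    ext S
    refine exists_congr fun P => and_congr_right fun hP => ?_
    rw [eq_comm]
    refine Eq.congr_left (Set.ext fun Q => and_congr_right fun _ => ?_)
    exact levelConnected_iff (hsub hP)
  rw [sizeFunction, hcl]
  refine Set.InjOn.ncard_image ?_
  rintro _ ⟨P, hP, rfl⟩ _ ⟨Q, hQ, rfl⟩ h
  have hm : P ∈ sublevel φ x ∩ connectedComponentIn (sublevel φ y) P :=
    ⟨hP, mem_connectedComponentIn (hsub hP)⟩
  have h' : sublevel φ x ∩ connectedComponentIn (sublevel φ y) P =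
    sublevel φ x ∩ connectedComponentIn (sublevel φ y) Q := h
  rw [h'] at hm
  exact (connectedComponentIn_eq hm.2).symm

theorem finite_components_real [CompactSpace X] [LocallyConnectedSpace X] {f : X → ℝ}
    (hf : Continuous f) {x y : ℝ} (hxy : x < y) :
    (connectedComponentIn (sublevel f y) '' sublevel f x).Finite := by
  refine Set.Finite.of_finite_image (f := fun C => sublevel f x ∩ C)
    ((levelClasses_finite_real hf hxy).subset ?_) ?_
  · rintro _ ⟨_, ⟨P, hP, rfl⟩, rfl⟩
    refine ⟨P, hP, Set.ext fun Q => and_congr_right fun _ => ?_⟩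
    exact (levelConnected_iff (sublevel_mono f hxy.le hP)).symm
  · rintro _ ⟨P, hP, rfl⟩ _ ⟨Q, hQ, rfl⟩ h
    have hm : P ∈ sublevel f x ∩ connectedComponentIn (sublevel f y) P :=
      ⟨hP, mem_connectedComponentIn (sublevel_mono f hxy.le hP)⟩
    have h' : sublevel f x ∩ connectedComponentIn (sublevel f y) P =
      sublevel f x ∩ connectedComponentIn (sublevel f y) Q := h
    rw [h'] at hm
    exact (connectedComponentIn_eq hm.2).symm

/-- Components of a smaller set determine those of a larger one. -/
theorem exists_component_map {A B : Set X} (hAB : A ⊆ B) :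
    ∃ r : Set X → Set X, ∀ P ∈ A,
      r (connectedComponentIn A P) = connectedComponentIn B P := by
  classical
  refine ⟨fun S => if h : S.Nonempty then connectedComponentIn B h.some else ∅, fun P hP => ?_⟩
  have hne : (connectedComponentIn A P).Nonempty := ⟨P, mem_connectedComponentIn hP⟩
  simp only [dif_pos hne]
  exact (connectedComponentIn_eq (connectedComponentIn_mono P hAB hne.some_mem)).symm

/-- On the compact complement of `W` the function attains a minimum, which exceeds `t`; any `u`
strictly in between works. -/
theorem exists_sublevel_subset [CompactSpace X] {f : X → ℝ} (hf : Continuous f) {t : ℝ}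
    {W : Set X} (hW : IsOpen W) (h : sublevel f t ⊆ W) : ∃ u > t, sublevel f u ⊆ W := by
  rcases Set.eq_empty_or_nonempty Wᶜ with he | hne
  · rw [Set.compl_empty_iff] at he
    exact ⟨t + 1, by simp, he ▸ Set.subset_univ _⟩
  · obtain ⟨P, hP, hmin⟩ := hW.isClosed_compl.isCompact.exists_isMinOn hne hf.continuousOn
    have htP : t < f P := not_le.1 fun hle => hP (h hle)
    obtain ⟨u, hu1, hu2⟩ := exists_between htP
    refine ⟨u, hu1, fun Q hQ => by_contra fun hQW => ?_⟩
    have h1 : f P ≤ f Q := hmin hQW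
    exact absurd (h1.trans hQ) (not_le.2 hu2)

/-- Points in different components of `M⟨f ≤ t⟩` are in different components of
`M⟨f ≤ u⟩` for some `u > t`. -/
theorem exists_gt_components_ne [CompactSpace X] [T2Space X] {f : X → ℝ} (hf : Continuous f)
    {t : ℝ} {P Q : X} (hP : P ∈ sublevel f t) (hQ : Q ∈ sublevel f t)
    (h : connectedComponentIn (sublevel f t) P ≠ connectedComponentIn (sublevel f t) Q) :
    ∃ u > t, ∀ v, t ≤ v → v ≤ u →
      connectedComponentIn (sublevel f v) P ≠ connectedComponentIn (sublevel f v) Q := by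
  have hcl : IsClosed (sublevel f t) := isClosed_Iic.preimage hf
  have : CompactSpace (sublevel f t) := isCompact_iff_compactSpace.1 hcl.isCompact
  have hnot : (⟨Q, hQ⟩ : sublevel f t) ∉ connectedComponent (⟨P, hP⟩ : sublevel f t) := by
    intro hmem
    refine h (connectedComponentIn_eq ?_)
    rw [connectedComponentIn_eq_image hP]
    exact ⟨_, hmem, rfl⟩
  -- In a compact Hausdorff space components are intersections of clopen sets, so some clopen `Z`
  -- separates `P` from `Q`. Disjoint open neighbourhoods of `Z` and its complement still cover the
  -- sublevel sets slightly above `t`, and a connected set cannot meet both.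
  rw [connectedComponent_eq_iInter_isClopen, Set.mem_iInter] at hnot
  obtain ⟨⟨Z, hZ, hPZ⟩, hQZ⟩ := not_forall.1 hnot
  have h1 : IsCompact ((↑) '' Z : Set X) := hZ.1.isCompact.image continuous_subtype_val
  have h2 : IsCompact ((↑) '' Zᶜ : Set X) := hZ.compl.1.isCompact.image continuous_subtype_val
  have hd : Disjoint ((↑) '' Z : Set X) ((↑) '' Zᶜ) :=
    (Set.disjoint_image_iff Subtype.val_injective).2 disjoint_compl_right
  obtain ⟨U, V, hU, hV, hZU, hZV, hUV⟩ := SeparatedNhds.of_isCompact_isCompact h1 h2 hd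
  obtain ⟨u, hu, hsub⟩ := exists_sublevel_subset hf (t := t) (hU.union hV) (by
    intro R hR
    by_cases hRZ : (⟨R, hR⟩ : sublevel f t) ∈ Z
    · exact Or.inl (hZU ⟨_, hRZ, rfl⟩)
    · exact Or.inr (hZV ⟨_, hRZ, rfl⟩))
  refine ⟨u, hu, fun v htv hvu heq => ?_⟩
  have hPv := sublevel_mono f htv hP
  have hQv := sublevel_mono f htv hQ
  have hCU : connectedComponentIn (sublevel f v) P ⊆ U :=
    isPreconnected_connectedComponentIn.subset_left_of_subset_union hU hV hUV
      ((connectedComponentIn_subset _ _).trans ((sublevel_mono f hvu).trans hsub))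
      ⟨P, mem_connectedComponentIn hPv, hZU ⟨_, hPZ, rfl⟩⟩
  have hQU : Q ∈ U := hCU (heq ▸ mem_connectedComponentIn hQv)
  exact Set.disjoint_left.1 hUV hQU (hZV ⟨⟨Q, hQ⟩, hQZ, rfl⟩)

end Sublevel

/-! ### One-dimensional size functions as rank functions -/

/-- The properties of one-dimensional size functions on `x < y` from which they can be
recovered by counting cornerpoints. -/
structure RankFunction (ℓ : ℝ → ℝ → ℕ) : Prop where
  mono : ∀ {x₁ x₂ y}, x₁ ≤ x₂ → x₂ < y → ℓ x₁ y ≤ ℓ x₂ y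
  rect : ∀ {x₁ x₂ y₁ y₂}, x₁ ≤ x₂ → x₂ < y₁ → y₁ ≤ y₂ →
    ℓ x₂ y₂ + ℓ x₁ y₁ ≤ ℓ x₂ y₁ + ℓ x₁ y₂
  right_left : ∀ {x y}, x < y → ∃ x' > x, x' < y ∧ ℓ x' y = ℓ x y
  right_right : ∀ {x y}, x < y → ∃ y' > y, ℓ x y' = ℓ x y
  zero : ∃ a, ∀ {x y}, x ≤ a → x < y → ℓ x y = 0
  stable : ∃ B, ∀ {x y y'}, B ≤ y → B ≤ y' → x < y → x < y' → ℓ x y = ℓ x y'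

/-- This is `rect` with the left abscissa so low that `ℓ` vanishes there. -/
theorem RankFunction.anti {ℓ : ℝ → ℝ → ℕ} (h : RankFunction ℓ) {x y₁ y₂ : ℝ} (hxy : x < y₁)
    (hy : y₁ ≤ y₂) : ℓ x y₂ ≤ ℓ x y₁ := by
  obtain ⟨a, ha⟩ := h.zero
  have h1 := h.rect (min_le_left x a) hxy hy
  rw [ha (min_le_right x a) ((min_le_left x a).trans_lt hxy),
    ha (min_le_right x a) ((min_le_left x a).trans_lt (hxy.trans_le hy))] at h1
  simpa using h1

theorem rankFunction_sizeFunction {X : Type*} [TopologicalSpace X] [Nonempty X] [CompactSpace X]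
    [LocallyConnectedSpace X] [T2Space X] {f : X → ℝ} (hf : Continuous f) :
    RankFunction (sizeFunction f) where
  mono {x₁ x₂ y} h1 h2 := by
    rw [sizeFunction_eq_ncard f h2.le, sizeFunction_eq_ncard f (h1.trans h2.le)]
    exact Set.ncard_le_ncard (Set.image_mono (sublevel_mono f h1))
      (finite_components_real hf h2)
  rect {x₁ x₂ y₁ y₂} h1 h2 h3 := by
    rw [sizeFunction_eq_ncard f h2.le, sizeFunction_eq_ncard f (h1.trans h2.le),
      sizeFunction_eq_ncard f (h2.le.trans h3), sizeFunction_eq_ncard f (h1.trans (h2.le.trans h3))]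
    obtain ⟨r, hr⟩ := exists_component_map (sublevel_mono f h3)
    have him : ∀ x ≤ y₁, connectedComponentIn (sublevel f y₂) '' sublevel f x =
        r '' (connectedComponentIn (sublevel f y₁) '' sublevel f x) := fun x hx => by
      rw [Set.image_image]
      exact Set.image_congr fun P hP => (hr P (sublevel_mono f hx hP)).symm
    rw [him x₁ (h1.trans h2.le), him x₂ h2.le]
    have hfin := finite_components_real hf h2
    have hAB := Set.image_mono (f := connectedComponentIn (sublevel f y₁)) (sublevel_mono f h1)
    generalize connectedComponentIn (sublevel f y₁) '' sublevel f x₁ = A at *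
    generalize connectedComponentIn (sublevel f y₁) '' sublevel f x₂ = B at *
    have e1 := Set.ncard_sdiff_add_ncard_of_subset hAB hfin
    have e2 := Set.ncard_sdiff_add_ncard_of_subset (Set.image_mono (f := r) hAB) (hfin.image r)
    -- Passing to the higher level is a map `r` on components, and it cannot increase the number of
    -- components in `B` not already represented in `A`.
    have e3 : (r '' B \ r '' A).ncard ≤ (B \ A).ncard :=
      (Set.ncard_le_ncard (by
        rintro _ ⟨⟨C, hC, rfl⟩, hCA⟩
        exact ⟨C, ⟨hC, fun h => hCA ⟨C, h, rfl⟩⟩, rfl⟩) (hfin.sdiff.image r)).trans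
        (Set.ncard_image_le hfin.sdiff)
    omega
  right_left {x y} hxy := by
    have ho : IsOpen {Q | f Q < y} := isOpen_Iio.preimage hf
    -- `W` is open by local connectedness, so it contains a slightly higher sublevel set; the points
    -- added there lie in components of `M⟨f ≤ y⟩` already counted.
    let W : Set X := ⋃ P ∈ sublevel f x, connectedComponentIn {Q | f Q < y} P
    have hWo : IsOpen W := isOpen_biUnion fun P _ => ho.connectedComponentIn
    obtain ⟨u, hu, hsub⟩ := exists_sublevel_subset hf (t := x) hWo fun P hP =>
      Set.mem_biUnion hP (mem_connectedComponentIn (lt_of_le_of_lt hP hxy))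
    obtain ⟨v, hv1, hv2⟩ := exists_between (lt_min hu hxy)
    have hvu := (hv2.trans_le (min_le_left _ _)).le
    have hvy := hv2.trans_le (min_le_right _ _)
    refine ⟨v, hv1, hvy, ?_⟩
    rw [sizeFunction_eq_ncard f hvy.le, sizeFunction_eq_ncard f hxy.le]
    congr 1
    refine Set.Subset.antisymm ?_ (Set.image_mono (sublevel_mono f hv1.le))
    rintro _ ⟨Q, hQ, rfl⟩
    obtain ⟨P, hP, hQP⟩ := Set.mem_iUnion₂.1 (hsub (sublevel_mono f hvu hQ))
    exact ⟨P, hP, connectedComponentIn_eq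
      (connectedComponentIn_mono P (fun R (hR : f R < y) => hR.le) hQP)⟩
  right_right {x y} hxy := by
    -- `F` picks one representative per component. It is finite, so a single level `v > y` keeps all
    -- its pairs separated.
    obtain ⟨F, hF, hinj, hFim⟩ : ∃ F : Set X, F ⊆ sublevel f x ∧
        Set.InjOn (connectedComponentIn (sublevel f y)) F ∧
        connectedComponentIn (sublevel f y) '' F =
          connectedComponentIn (sublevel f y) '' sublevel f x := by
      obtain ⟨F, hF, hb⟩ := Set.SurjOn.exists_bijOn_subset
        (Set.surjOn_image (connectedComponentIn (sublevel f y)) (sublevel f x))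
      exact ⟨F, hF, hb.injOn, hb.image_eq⟩
    have hFfin : F.Finite := Set.Finite.of_finite_image
      (hFim ▸ finite_components_real hf hxy) hinj
    have hev : ∀ᶠ v in nhdsWithin y (Set.Ioi y), ∀ P ∈ F, ∀ Q ∈ F, P ≠ Q →
        connectedComponentIn (sublevel f v) P ≠ connectedComponentIn (sublevel f v) Q := by
      rw [Filter.eventually_all_finite hFfin]
      intro P hP
      rw [Filter.eventually_all_finite hFfin]
      intro Q hQ
      by_cases hPQ : P = Q
      · simp [hPQ]
      obtain ⟨u, hu, hne⟩ := exists_gt_components_ne hf (sublevel_mono f hxy.le (hF hP))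
        (sublevel_mono f hxy.le (hF hQ)) fun h => hPQ (hinj hP hQ h)
      filter_upwards [Ioc_mem_nhdsGT hu] with v hv _
      exact hne v hv.1.le hv.2
    obtain ⟨v, hv, hyv⟩ := (hev.and self_mem_nhdsWithin).exists
    have hyv : y < v := hyv
    refine ⟨v, hyv, ?_⟩
    rw [sizeFunction_eq_ncard f (hxy.trans hyv).le, sizeFunction_eq_ncard f hxy.le]
    obtain ⟨r, hr⟩ := exists_component_map (sublevel_mono f hyv.le)
    have him : connectedComponentIn (sublevel f v) '' sublevel f x =
        r '' (connectedComponentIn (sublevel f y) '' sublevel f x) := by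
      rw [Set.image_image]
      exact Set.image_congr fun P hP => (hr P (sublevel_mono f hxy.le hP)).symm
    rw [him]
    refine Set.InjOn.ncard_image ?_
    rw [← hFim]
    rintro _ ⟨P, hP, rfl⟩ _ ⟨Q, hQ, rfl⟩ h
    rw [hr P (sublevel_mono f hxy.le (hF hP)), hr Q (sublevel_mono f hxy.le (hF hQ))] at h
    by_contra hne
    exact hv P hP Q hQ (fun h' => hne (h' ▸ rfl)) h
  zero := by
    obtain ⟨P, -, hP⟩ := isCompact_univ.exists_isMinOn Set.univ_nonempty hf.continuousOn
    refine ⟨f P - 1, fun {x y} hx hxy => ?_⟩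
    have he : sublevel f x = ∅ := Set.eq_empty_of_forall_notMem fun Q hQ => by
      have h1 : f P ≤ f Q := hP (Set.mem_univ Q)
      have h2 : f Q ≤ x := hQ
      linarith
    rw [sizeFunction_eq_ncard f hxy.le, he, Set.image_empty, Set.ncard_empty]
  stable := by
    obtain ⟨P, -, hP⟩ := isCompact_univ.exists_isMaxOn Set.univ_nonempty hf.continuousOn
    have hu : ∀ y, f P ≤ y → sublevel f y = Set.univ := fun y hy =>
      Set.eq_univ_of_forall fun Q => (show f Q ≤ f P from hP (Set.mem_univ Q)).trans hy
    refine ⟨f P, fun {x y y'} hy hy' hxy hxy' => ?_⟩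
    rw [sizeFunction_eq_ncard f hxy.le, sizeFunction_eq_ncard f hxy'.le, hu y hy, hu y' hy']

/-! ### Sums of jumps -/

/-- A right-continuous nondecreasing step function that starts at `0` is the sum of its jumps. -/
theorem nonempty_fin_equiv_sigma_jumps {h j : ℝ → ℕ} {S : Set ℝ} {a s : ℝ} (has : a ≤ s)
    (hS : Set.Ioc a s ⊆ S) (h0 : h a = 0) (hmono : MonotoneOn h (Set.Icc a s))
    (hrc : ∀ x, a ≤ x → x < s → ∃ y > x, y ≤ s ∧ h y = h x)
    (hj : ∀ x ∈ Set.Ioc a s, ∃ y, a ≤ y ∧ y < x ∧ ∀ z ∈ Set.Ico y x, h z + j x = h x)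
    (hj0 : ∀ x ∈ S, x ∉ Set.Ioc a s → j x = 0) :
    Nonempty (Fin (h s) ≃ Σ x : S, Fin (j x)) := by
  -- The unit `n` of the height `h s` is assigned to the place where `h` first exceeds `n`. The
  -- units assigned to `x` are then those from the value of `h` just left of `x` up to `h x`, which
  -- are `j x` in number.
  have key : ∀ n : Fin (h s), ∃ x ∈ Set.Ioc a s, ∀ z ∈ Set.Icc a s, n < h z ↔ x ≤ z := by
    intro n
    let A : Set ℝ := {x | x ∈ Set.Icc a s ∧ (n : ℕ) < h x}
    have hsA : s ∈ A := ⟨⟨has, le_rfl⟩, n.2⟩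
    have hbdd : BddBelow A := ⟨a, fun x hx => hx.1.1⟩
    have h1 : a ≤ sInf A := le_csInf ⟨s, hsA⟩ fun x hx => hx.1.1
    have h2 : sInf A ≤ s := csInf_le hbdd hsA
    -- Right-continuity makes the infimum attained.
    have h3 : (n : ℕ) < h (sInf A) := by
      by_contra hn
      have hlt : sInf A < s := h2.lt_of_ne fun he =>
        hn (n.2.trans_eq (congrArg h he.symm))
      obtain ⟨y, hy1, hy2, hy3⟩ := hrc _ h1 hlt
      obtain ⟨x, hx, hxy⟩ := exists_lt_of_csInf_lt ⟨s, hsA⟩ hy1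
      have := hmono hx.1 ⟨h1.trans hy1.le, hy2⟩ hxy.le
      have := hx.2
      omega
    refine ⟨sInf A, ⟨h1.lt_of_ne fun he => ?_, h2⟩, fun z hz => ⟨fun hn => csInf_le hbdd ⟨hz, hn⟩,
      fun hz' => h3.trans_le (hmono ⟨h1, h2⟩ hz hz')⟩⟩
    rw [← he, h0] at h3
    omega
  choose g hg hgz using key
  let G : Fin (h s) → S := fun n => ⟨g n, hS (hg n)⟩
  refine ⟨(Equiv.sigmaFiberEquiv G).symm.trans (Equiv.sigmaCongrRight fun x => Classical.choice ?_)⟩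
  obtain ⟨x, hxS⟩ := x
  by_cases hx : x ∈ Set.Ioc a s
  · obtain ⟨y, hay, hyx, hyz⟩ := hj x hx
    have hxI : x ∈ Set.Icc a s := ⟨hx.1.le, hx.2⟩
    have hy := hyz y ⟨le_rfl, hyx⟩
    have hxs : h x ≤ h s := hmono hxI ⟨has, le_rfl⟩ hx.2
    have hfib : ∀ n : Fin (h s), G n = ⟨x, hxS⟩ ↔ h y ≤ n ∧ (n : ℕ) < h x := by
      intro n
      have e1 := hgz n x hxI
      have e2 := hgz n y ⟨hay, hyx.le.trans hx.2⟩
      rw [Subtype.mk.injEq]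
      constructor
      · intro hgx
        rw [hgx] at e1 e2
        exact ⟨not_lt.1 fun hn => absurd (e2.1 hn) (not_le.2 hyx), e1.2 le_rfl⟩
      · rintro ⟨hn1, hn2⟩
        refine le_antisymm (e1.1 hn2) (not_lt.1 fun hlt => ?_)
        have hm : max y (g n) ∈ Set.Ico y x := ⟨le_max_left _ _, max_lt hyx hlt⟩
        have e3 := (hgz n (max y (g n)) ⟨hay.trans hm.1, hm.2.le.trans hx.2⟩).2 (le_max_right _ _)
        have := hyz _ hm
        omega
    refine ⟨(Equiv.subtypeEquivRight hfib).trans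
      { toFun := fun n => ⟨n.1 - h y, by dsimp only; have := n.2; omega⟩
        invFun := fun i => ⟨⟨h y + i, by have := i.2; dsimp only at this; omega⟩, by simp,
          by have := i.2; dsimp only at this ⊢; omega⟩
        left_inv := fun n => by
          have := n.2
          ext
          simp only
          omega
        right_inv := fun i => by ext; simp }⟩
  · have h1 : IsEmpty {n // G n = ⟨x, hxS⟩} :=
      ⟨fun n => hx (by have := hg n.1; rwa [show g n.1 = x from congrArg Subtype.val n.2] at this)⟩
    have h2 : IsEmpty (Fin (j x)) := by rw [hj0 x hxS hx]; infer_instance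
    exact ⟨Equiv.equivOfIsEmpty _ _⟩

/-- The jump of `ℓ(·, y)` at `x` from the left. -/
noncomputable def leftJump (ℓ : ℝ → ℝ → ℕ) (x y : ℝ) : ℕ :=
  sInf {n : ℕ | ∃ z < x, n = ℓ x y - ℓ z y}

namespace RankFunction

variable {ℓ : ℝ → ℝ → ℕ} (h : RankFunction ℓ)
include h

/-- An infimum of naturals is attained, at some `w`, and monotonicity keeps the difference minimal
for `z` between `w` and `x`. Monotonicity also makes the truncated subtraction in `leftJump`
harmless. -/
theorem exists_leftJump {x y : ℝ} (hxy : x < y) :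
    ∃ w < x, ∀ z ∈ Set.Ico w x, ℓ z y + leftJump ℓ x y = ℓ x y := by
  obtain ⟨w, hw, hwj⟩ := Nat.sInf_mem (s := {n : ℕ | ∃ z < x, n = ℓ x y - ℓ z y})
    ⟨_, x - 1, by simp, rfl⟩
  change leftJump ℓ x y = _ at hwj
  refine ⟨w, hw, fun z hz => ?_⟩
  have h1 : leftJump ℓ x y ≤ ℓ x y - ℓ z y := Nat.sInf_le ⟨z, hz.2, rfl⟩
  have h2 := h.mono hz.1 (hz.2.trans hxy)
  have h3 := h.mono hz.2.le hxy
  omega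

theorem add_leftJump_le {x y z : ℝ} (hxy : x < y) (hz : z < x) :
    ℓ z y + leftJump ℓ x y ≤ ℓ x y := by
  have h1 : leftJump ℓ x y ≤ ℓ x y - ℓ z y := Nat.sInf_le ⟨z, hz, rfl⟩
  have h3 := h.mono hz.le hxy
  omega

/-- Left jumps at two levels are simultaneously attained near `x`. -/
theorem exists_leftJump_pair {x y y' : ℝ} (hxy : x < y) (hxy' : x < y') :
    ∃ w < x, ∀ z ∈ Set.Ico w x, ℓ z y + leftJump ℓ x y = ℓ x y ∧
      ℓ z y' + leftJump ℓ x y' = ℓ x y' := by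
  obtain ⟨w, hw, hw'⟩ := h.exists_leftJump hxy
  obtain ⟨v, hv, hv'⟩ := h.exists_leftJump hxy'
  exact ⟨max w v, max_lt hw hv, fun z hz => ⟨hw' z ⟨(le_max_left _ _).trans hz.1, hz.2⟩,
    hv' z ⟨(le_max_right _ _).trans hz.1, hz.2⟩⟩⟩

theorem leftJump_anti {x y y' : ℝ} (hxy : x < y) (hyy' : y ≤ y') :
    leftJump ℓ x y' ≤ leftJump ℓ x y := by
  obtain ⟨w, hw, hz⟩ := h.exists_leftJump_pair hxy (hxy.trans_le hyy')
  have := hz w ⟨le_rfl, hw⟩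
  have := h.rect hw.le hxy hyy'
  omega

/-- Up to `y'` the value at `x` is unchanged, while the values to the left of `x` can only drop, so
the jump does not decrease. -/
theorem leftJump_right {x y : ℝ} (hxy : x < y) : ∃ y' > y, ∀ u, y ≤ u → u ≤ y' →
    leftJump ℓ x u = leftJump ℓ x y := by
  obtain ⟨y', hy', he⟩ := h.right_right hxy
  refine ⟨y', hy', fun u hu hu' => le_antisymm (h.leftJump_anti hxy hu) ?_⟩
  refine le_trans ?_ (h.leftJump_anti (hxy.trans_le hu) hu')
  obtain ⟨w, hw, hz⟩ := h.exists_leftJump_pair hxy (hxy.trans hy')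
  have := hz w ⟨le_rfl, hw⟩
  have := h.anti (hw.trans hxy) hy'.le
  omega

theorem right_left_le {x y : ℝ} (hxy : x < y) :
    ∃ x' > x, ∀ u, x ≤ u → u ≤ x' → ℓ u y = ℓ x y := by
  obtain ⟨x', hx', hy, he⟩ := h.right_left hxy
  refine ⟨x', hx', fun u hu hu' => le_antisymm ?_ (h.mono hu (hu'.trans_lt hy))⟩
  rw [← he]
  exact h.mono hu' hy

/-- The multiplicity is a mixed second difference of `ℓ` over a square around `(x, y)`. By `rect` it
is monotone in the rectangle, and for thin rectangles it is the drop of the left jump at `x` as the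
level crosses `y`. The witness is `t = y - ε`, with `ε` attaining the minimum. -/
theorem properMult_add {x y : ℝ} (hxy : x < y) :
    ∃ t, x < t ∧ t < y ∧ ∀ z ∈ Set.Ico t y,
      leftJump ℓ x y + properMult ℓ x y = leftJump ℓ x z := by
  have hmem : ∃ ε : ℝ, 0 < ε ∧ x + ε < y - ε ∧ ((properMult ℓ x y : ℕ) : ℤ) =
      ℓ (x + ε) (y - ε) - ℓ (x - ε) (y - ε) - ℓ (x + ε) (y + ε) + ℓ (x - ε) (y + ε) := by
    refine Nat.sInf_mem (s := {n : ℕ | ∃ ε : ℝ, 0 < ε ∧ x + ε < y - ε ∧ (n : ℤ) =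
      ℓ (x + ε) (y - ε) - ℓ (x - ε) (y - ε) - ℓ (x + ε) (y + ε) + ℓ (x - ε) (y + ε)}) ?_
    have := h.rect (x₁ := x - (y - x) / 4) (x₂ := x + (y - x) / 4) (y₁ := y - (y - x) / 4)
      (y₂ := y + (y - x) / 4) (by linarith) (by linarith) (by linarith)
    refine ⟨_, (y - x) / 4, by linarith, by linarith, Int.toNat_of_nonneg ?_⟩
    omega
  obtain ⟨ε, hε, hxε, hm⟩ := hmem
  refine ⟨y - ε, by linarith, by linarith, fun z ⟨hz1, hz2⟩ => le_antisymm ?_ ?_⟩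
  -- The square of half-side `δ` is a competitor in the minimum; `δ` is so small that its second
  -- difference is at most the drop of the jump from `z` to `y`.
  · have hxz : x < z := by linarith
    obtain ⟨w, hw, hwj⟩ := h.exists_leftJump hxz
    obtain ⟨u, hu, hux⟩ := h.right_left_le hxz
    obtain ⟨v, hv, hvy⟩ := h.leftJump_right hxy
    set δ := min (min (x - w) (u - x)) (min (v - y) ((y - z) / 2)) with hδ
    have d1 : δ ≤ x - w := (min_le_left _ _).trans (min_le_left _ _)
    have d2 : δ ≤ u - x := (min_le_left _ _).trans (min_le_right _ _)
    have d3 : δ ≤ v - y := (min_le_right _ _).trans (min_le_left _ _)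
    have d4 : δ ≤ (y - z) / 2 := (min_le_right _ _).trans (min_le_right _ _)
    have d0 : 0 < δ := lt_min (lt_min (by linarith) (by linarith)) (lt_min (by linarith)
      (by linarith))
    have e1 := hwj (x - δ) ⟨by linarith, by linarith⟩
    have e2 := hux (x + δ) (by linarith) (by linarith)
    have e3 := hvy (y + δ) (by linarith) (by linarith)
    have e4 := h.add_leftJump_le (x := x) (y := y + δ) (z := x - δ) (by linarith) (by linarith)
    have e5 := h.mono (x₁ := x) (x₂ := x + δ) (y := y + δ) (by linarith) (by linarith)
    have r1 := h.rect (x₁ := x - δ) (x₂ := x + δ) (y₁ := z) (y₂ := y - δ) (by linarith)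
      (by linarith) (by linarith)
    have r2 := h.rect (x₁ := x - δ) (x₂ := x + δ) (y₁ := y - δ) (y₂ := y + δ) (by linarith)
      (by linarith) (by linarith)
    have hle : properMult ℓ x y ≤ (((ℓ (x + δ) (y - δ) - ℓ (x - δ) (y - δ) - ℓ (x + δ) (y + δ) +
        ℓ (x - δ) (y + δ) : ℤ)).toNat) :=
      Nat.sInf_le ⟨δ, d0, by linarith, Int.toNat_of_nonneg (by omega)⟩
    omega
  -- Conversely, the rectangle between `v` and `x`, `z` and `y` lies in the minimising square, and
  -- its second difference is that drop.
  · have hxz : x < z := by linarith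
    obtain ⟨w, hw, hwj⟩ := h.exists_leftJump_pair hxz hxy
    have hv1 : x - ε ≤ max w (x - ε) := le_max_right _ _
    have hv2 : max w (x - ε) < x := max_lt hw (by linarith)
    have hv := hwj _ ⟨le_max_left _ _, hv2⟩
    generalize max w (x - ε) = v at *
    have r1 := h.rect (x₁ := v) (x₂ := x) (y₁ := y - ε) (y₂ := z) hv2.le (by linarith) hz1
    have r2 := h.rect (x₁ := x - ε) (x₂ := v) (y₁ := y - ε) (y₂ := y) hv1 (by linarith)
      (by linarith)
    have r3 := h.rect (x₁ := x) (x₂ := x + ε) (y₁ := y - ε) (y₂ := y) (by linarith) hxε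
      (by linarith)
    have r4 := h.rect (x₁ := x - ε) (x₂ := x + ε) (y₁ := y) (y₂ := y + ε) (by linarith)
      (by linarith) (by linarith)
    omega

/-- Above the level `B` of `stable` the ordinate is irrelevant, so for small `ε` the difference
defining `infinityMult` is the left jump at `T`. -/
theorem infinityMult_eq : ∃ B, ∀ {x T : ℝ}, B ≤ T → x < T → leftJump ℓ x T = infinityMult ℓ x := by
  obtain ⟨B, hB⟩ := h.stable
  refine ⟨B, fun {x T} hT hxT => ?_⟩
  obtain ⟨w, hw, hwj⟩ := h.exists_leftJump hxT
  obtain ⟨u, hu, hux⟩ := h.right_left_le hxT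
  -- `R` is the lower bound to impose on `1 / ε`: positive, at least `B`, and beyond `x + ε` once `ε
  -- ≤ 1`.
  set R := max 1 (max B (x + 2)) with hR
  have R1 : 1 ≤ R := le_max_left _ _
  have R2 : B ≤ R := (le_max_left _ _).trans (le_max_right _ _)
  have R3 : x + 2 ≤ R := (le_max_right _ _).trans (le_max_right _ _)
  set ε := min (1 / R) (min (min (x - w) (u - x)) ((T - x) / 2)) with hε
  have d1 : ε ≤ x - w := ((min_le_right _ _).trans (min_le_left _ _)).trans (min_le_left _ _)
  have d2 : ε ≤ u - x := ((min_le_right _ _).trans (min_le_left _ _)).trans (min_le_right _ _)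
  have d3 : ε ≤ (T - x) / 2 := (min_le_right _ _).trans (min_le_right _ _)
  have d0 : 0 < ε := lt_min (by positivity) (lt_min (lt_min (by linarith) (by linarith))
    (by linarith))
  have d4 : R ≤ 1 / ε := (le_one_div d0 (by linarith)).1 (min_le_left _ _)
  have d5 : ε ≤ 1 := (min_le_left _ _).trans ((div_le_one (by linarith)).2 R1)
  have e1 := hwj (x - ε) ⟨by linarith, by linarith⟩
  have e2 := hux (x + ε) (by linarith) (by linarith)
  have e3 := hB (x := x + ε) (R2.trans d4) hT (by linarith) (by linarith)
  have e4 := hB (x := x - ε) (R2.trans d4) hT (by linarith) (by linarith)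
  have hcand : ∃ ε : ℝ, 0 < ε ∧ x + ε < 1 / ε ∧
      ((leftJump ℓ x T : ℕ) : ℤ) = ℓ (x + ε) (1 / ε) - ℓ (x - ε) (1 / ε) :=
    ⟨ε, d0, by linarith, by omega⟩
  refine le_antisymm ?_ (Nat.sInf_le hcand)
  obtain ⟨η, hη, hxη, hm⟩ := Nat.sInf_mem (s := {n : ℕ | ∃ ε : ℝ, 0 < ε ∧ x + ε < 1 / ε ∧
    (n : ℤ) = ℓ (x + ε) (1 / ε) - ℓ (x - ε) (1 / ε)}) ⟨_, hcand⟩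
  change ((infinityMult ℓ x : ℕ) : ℤ) = _ at hm
  -- The minimiser `η` may have `1 / η` below `B`, so the comparison takes place at the larger of `1
  -- / η` and `T`.
  have m1 : 1 / η ≤ max (1 / η) T := le_max_left _ _
  have m2 : T ≤ max (1 / η) T := le_max_right _ _
  generalize max (1 / η) T = T' at *
  have f1 := h.rect (x₁ := x - η) (x₂ := x + η) (by linarith) hxη m1
  have f2 := h.mono (x₁ := x) (x₂ := x + η) (y := T') (by linarith) (by linarith)
  have f3 := hB (x := x) hT (hT.trans m2) hxT (by linarith)
  have f4 := hB (x := x - η) hT (hT.trans m2) (by linarith) (by linarith)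
  have f5 := h.add_leftJump_le (z := x - η) hxT (by linarith)
  omega

end RankFunction

/-! ### Size functions count cornerpoints -/

/-- The points of the extended plane lying to the left of `s` (weakly) and above `t` (strictly). -/
def ExtPoint.UpperLeft (s t : ℝ) : ExtPoint → Prop
  | .proper x y => x ≤ s ∧ t < y
  | .atInfinity k => k ≤ s

theorem mult_proper (ℓ : ℝ → ℝ → ℕ) {x y : ℝ} (hxy : x < y) :
    mult ℓ (.proper x y) = properMult ℓ x y := if_pos hxy

theorem mult_atInfinity (ℓ : ℝ → ℝ → ℕ) (k : ℝ) : mult ℓ (.atInfinity k) = infinityMult ℓ k := rfl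

/-- The cornerpoints to the left of `s` and above `t`, listed by abscissa and ordinate. -/
noncomputable def upperLeftEquiv (ℓ : ℝ → ℝ → ℕ) {s t : ℝ} (hst : s < t) :
    {c : Diagram ℓ // c.1.UpperLeft s t} ≃
      Σ x : Set.Iic s, (Σ y : Set.Ioi t, Fin (properMult ℓ x y)) ⊕ Fin (infinityMult ℓ x) where
  -- Here `x ≤ s < t < y`, so diagonal points never occur and all multiplicities are finite.
  toFun
    | ⟨⟨.proper x y, n⟩, h⟩ => ⟨⟨x, h.1⟩, .inl ⟨⟨y, h.2⟩, n.1, Nat.cast_lt.1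
        (n.2.trans_eq (mult_proper ℓ (h.1.trans_lt (hst.trans h.2))))⟩⟩
    | ⟨⟨.atInfinity k, n⟩, h⟩ => ⟨⟨k, h⟩, .inr ⟨n.1, Nat.cast_lt.1
        (n.2.trans_eq (mult_atInfinity ℓ k))⟩⟩
  invFun
    | ⟨x, .inl ⟨y, i⟩⟩ => ⟨⟨.proper x y, i.1, by
        rw [mult_proper ℓ (x.2.trans_lt (hst.trans y.2))]
        exact_mod_cast i.2⟩, x.2, y.2⟩
    | ⟨x, .inr i⟩ => ⟨⟨.atInfinity x, i.1, by
        rw [mult_atInfinity]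
        exact_mod_cast i.2⟩, x.2⟩
  left_inv := by rintro ⟨⟨_ | _, n⟩, h⟩ <;> rfl
  right_inv := by rintro ⟨x, y | i⟩ <;> rfl

namespace RankFunction

variable {ℓ : ℝ → ℝ → ℕ} (h : RankFunction ℓ)
include h

theorem nonempty_fin_equiv_leftJump {s t : ℝ} (hst : s < t) :
    Nonempty (Fin (ℓ s t) ≃ Σ x : Set.Iic s, Fin (leftJump ℓ x t)) := by
  obtain ⟨a, ha⟩ := h.zero
  refine nonempty_fin_equiv_sigma_jumps (h := fun x => ℓ x t) (j := fun x => leftJump ℓ x t)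
    (a := min a s) (min_le_right _ _) Set.Ioc_subset_Iic_self
    (ha (min_le_left _ _) ((min_le_right _ _).trans_lt hst))
    (fun x _ y hy hxy => h.mono hxy (hy.2.trans_lt hst)) (fun x _ hxs => ?_) (fun x hx => ?_)
    fun x hx hxa => ?_
  · obtain ⟨u, hu, hux⟩ := h.right_left_le (hxs.trans hst)
    exact ⟨min u s, lt_min hu hxs, min_le_right _ _,
      hux _ (le_min hu.le hxs.le) (min_le_left _ _)⟩
  · obtain ⟨w, hw, hz⟩ := h.exists_leftJump (hx.2.trans_lt hst)
    exact ⟨max w (min a s), le_max_right _ _, max_lt hw hx.1,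
      fun z hz' => hz z ⟨(le_max_left _ _).trans hz'.1, hz'.2⟩⟩
  · have hxs : x ≤ s := hx
    have hxm : x ≤ min a s := not_lt.1 fun hlt => hxa ⟨hlt, hxs⟩
    have h1 := h.add_leftJump_le (z := x - 1) (hxs.trans_lt hst) (by linarith)
    have h2 := ha (hxm.trans (min_le_left _ _)) (hxs.trans_lt hst)
    omega

/-- As the level `u` rises from `t`, the left jump at `x` loses `properMult ℓ x u` at each `u` and
is `infinityMult ℓ x` from `B` on. The sum-of-jumps lemma is applied to the amount lost between `t`
and `max B t`. -/
theorem nonempty_fin_leftJump_equiv {x t : ℝ} (hxt : x < t) :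
    Nonempty (Fin (leftJump ℓ x t) ≃
      (Σ y : Set.Ioi t, Fin (properMult ℓ x y)) ⊕ Fin (infinityMult ℓ x)) := by
  obtain ⟨B, hB⟩ := h.infinityMult_eq
  have key := nonempty_fin_equiv_sigma_jumps (h := fun u => leftJump ℓ x t - leftJump ℓ x u)
    (j := properMult ℓ x) (S := Set.Ioi t) (a := t) (s := max B t) (le_max_right _ _)
    Set.Ioc_subset_Ioi_self (Nat.sub_self _)
    (fun u hu v _ huv => Nat.sub_le_sub_left (h.leftJump_anti (hxt.trans_le hu.1) huv) _)
    (fun u htu hus => ?_) (fun u hu => ?_) fun u hu hu' => ?_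
  · obtain ⟨e⟩ := key
    have e1 := hB (le_max_left B t) (hxt.trans_le (le_max_right B t))
    have e2 := h.leftJump_anti hxt (le_max_right B t)
    exact ⟨(finCongr (by omega)).trans (finSumFinEquiv.symm.trans
      (Equiv.sumCongr e (Equiv.refl (Fin (infinityMult ℓ x)))))⟩
  · obtain ⟨v, hv, hvu⟩ := h.leftJump_right (hxt.trans_le htu)
    refine ⟨min v (max B t), lt_min hv hus, min_le_right _ _, ?_⟩
    rw [hvu _ (le_min hv.le hus.le) (min_le_left _ _)]
  · obtain ⟨w, hw, hwu, hz⟩ := h.properMult_add (hxt.trans hu.1)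
    refine ⟨max w t, le_max_right _ _, max_lt hwu hu.1, fun z hz' => ?_⟩
    have e1 := hz z ⟨(le_max_left _ _).trans hz'.1, hz'.2⟩
    have e2 := h.leftJump_anti hxt ((le_max_right w t).trans hz'.1)
    omega
  · have htu : t < u := hu
    have hBu : max B t < u := not_le.1 fun hle => hu' ⟨htu, hle⟩
    obtain ⟨w, hw, hwu, hz⟩ := h.properMult_add (hxt.trans htu)
    have e1 := hz (max w (max B t)) ⟨le_max_left _ _, max_lt hwu hBu⟩
    have e2 := hB ((le_max_left B t).trans hBu.le) (hxt.trans htu)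
    have e3 := hB ((le_max_left B t).trans (le_max_right w _)) (hw.trans_le (le_max_left w _))
    omega

/-- A size function counts, at `(s, t)`, the cornerpoints to the left of `s` and above `t`. -/
theorem nonempty_fin_equiv_upperLeft {s t : ℝ} (hst : s < t) :
    Nonempty (Fin (ℓ s t) ≃ {c : Diagram ℓ // c.1.UpperLeft s t}) := by
  obtain ⟨e⟩ := h.nonempty_fin_equiv_leftJump hst
  exact ⟨e.trans ((Equiv.sigmaCongrRight fun x => Classical.choice
    (h.nonempty_fin_leftJump_equiv (x.2.trans_lt hst))).trans (upperLeftEquiv ℓ hst).symm)⟩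

end RankFunction

/-! ### Vanishing matching distance -/

/-- A proper point in the region satisfies `(y - x) / 2 > (t - s) / 2 ≥ ε`, so the diagonal term of
the cost is too large: a cost below `ε` forces both coordinates to move by less than `ε`. -/
theorem ExtPoint.UpperLeft.of_pointCost_lt {p q : ExtPoint} {s t ε : ℝ}
    (hp : p.UpperLeft s t) (hε : ε ≤ (t - s) / 2) (hc : pointCost p q < ENNReal.ofReal ε) :
    q.UpperLeft (s + ε) (t - ε) := by
  match p, q with
  | .proper x y, .proper x' y' =>
    have hc' := (ENNReal.ofReal_lt_ofReal_iff' .. |>.1 hc).1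
    obtain ⟨hx, hy⟩ := hp
    rcases min_lt_iff.1 hc' with h | h
    · obtain ⟨h1, h2⟩ := max_lt_iff.1 h
      rw [abs_lt] at h1 h2
      exact ⟨by linarith, by linarith⟩
    · linarith [(max_lt_iff.1 h).1]
  | .atInfinity k, .atInfinity k' =>
    have hc' := (ENNReal.ofReal_lt_ofReal_iff' .. |>.1 hc).1
    rw [abs_lt] at hc'
    have : k ≤ s := hp
    exact show k' ≤ s + ε by linarith
  | .proper _ _, .atInfinity _ => exact absurd hc not_top_lt
  | .atInfinity _, .proper _ _ => exact absurd hc not_top_lt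

theorem ExtPoint.UpperLeft.mono {p : ExtPoint} {s t s' t' : ℝ} (hp : p.UpperLeft s t)
    (hs : s ≤ s') (ht : t' ≤ t) : p.UpperLeft s' t' := by
  match p with
  | .proper _ _ => exact ⟨hp.1.trans hs, ht.trans_lt hp.2⟩
  | .atInfinity _ => exact le_trans hp hs

theorem pointCost_comm (p q : ExtPoint) : pointCost p q = pointCost q p := by
  match p, q with
  | .proper x y, .proper x' y' =>
    simp only [pointCost, abs_sub_comm x x', abs_sub_comm y y', max_comm ((y - x) / 2)]
  | .atInfinity k, .atInfinity k' => simp only [pointCost, abs_sub_comm]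
  | .proper _ _, .atInfinity _ => rfl
  | .atInfinity _, .proper _ _ => rfl

theorem matchingDist_comm (ℓ₁ ℓ₂ : ℝ → ℝ → ℕ) : matchingDist ℓ₁ ℓ₂ = matchingDist ℓ₂ ℓ₁ := by
  have : ∀ ℓ₁ ℓ₂ : ℝ → ℝ → ℕ, matchingDist ℓ₁ ℓ₂ ≤ matchingDist ℓ₂ ℓ₁ := fun ℓ₁ ℓ₂ => by
    refine le_iInf fun σ => iInf_le_of_le σ.symm (iSup_le fun c => ?_)
    have := le_iSup (fun c => pointCost c.1 (σ c).1) (σ.symm c)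
    rwa [Equiv.apply_symm_apply, pointCost_comm] at this
  exact le_antisymm (this _ _) (this _ _)

theorem RankFunction.le_of_matchingDist_eq_zero {ℓ₁ ℓ₂ : ℝ → ℝ → ℕ} (h₁ : RankFunction ℓ₁)
    (h₂ : RankFunction ℓ₂) (hd : matchingDist ℓ₁ ℓ₂ = 0) {s t : ℝ} (hst : s < t) :
    ℓ₁ s t ≤ ℓ₂ s t := by
  obtain ⟨t', ht', he₁⟩ := h₁.right_right hst
  obtain ⟨s', hs', hst', he₂⟩ := h₂.right_left hst
  -- The first two bounds let the shifted count at `(s + ε, t' - ε)` fit inside the one at `(s',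
  -- t)`; the third keeps the counted points from being matched to the diagonal.
  set ε := min (min (s' - s) (t' - t)) ((t - s) / 2) with hε
  have d1 : ε ≤ s' - s := (min_le_left _ _).trans (min_le_left _ _)
  have d2 : ε ≤ t' - t := (min_le_left _ _).trans (min_le_right _ _)
  have d3 : ε ≤ (t - s) / 2 := min_le_right _ _
  have d0 : 0 < ε := lt_min (lt_min (by linarith) (by linarith)) (by linarith)
  obtain ⟨σ, hσ⟩ := iInf_lt_iff.1 (show matchingDist ℓ₁ ℓ₂ < ENNReal.ofReal ε by
    rw [hd]; exact ENNReal.ofReal_pos.2 d0)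
  obtain ⟨e₁⟩ := h₁.nonempty_fin_equiv_upperLeft (hst.trans ht')
  obtain ⟨e₂⟩ := h₂.nonempty_fin_equiv_upperLeft hst'
  let F : {c : Diagram ℓ₁ // c.1.UpperLeft s t'} → {c : Diagram ℓ₂ // c.1.UpperLeft s' t} :=
    fun c => ⟨σ c.1, (c.2.of_pointCost_lt (by linarith)
      ((le_iSup (fun c => pointCost c.1 (σ c).1) c.1).trans_lt hσ)).mono (by linarith)
        (by linarith)⟩
  have hF : Function.Injective F := fun c d hcd =>
    Subtype.ext (σ.injective (congrArg Subtype.val hcd))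
  rw [← he₁, ← he₂]
  simpa using Fintype.card_le_of_injective _
    (e₂.symm.injective.comp (hF.comp e₁.injective))

theorem RankFunction.eq_of_matchingDist_eq_zero {ℓ₁ ℓ₂ : ℝ → ℝ → ℕ} (h₁ : RankFunction ℓ₁)
    (h₂ : RankFunction ℓ₂) (hd : matchingDist ℓ₁ ℓ₂ = 0) {s t : ℝ} (hst : s < t) :
    ℓ₁ s t = ℓ₂ s t :=
  le_antisymm (h₁.le_of_matchingDist_eq_zero h₂ hd hst)
    (h₂.le_of_matchingDist_eq_zero h₁ (matchingDist_comm ℓ₁ ℓ₂ ▸ hd) hst)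

theorem mult_congr {ℓ₁ ℓ₂ : ℝ → ℝ → ℕ} (h : ∀ s t, s < t → ℓ₁ s t = ℓ₂ s t) :
    mult ℓ₁ = mult ℓ₂ := by
  have hp : ∀ x y, properMult ℓ₁ x y = properMult ℓ₂ x y := fun x y => by
    unfold properMult
    congr 1
    ext n
    refine exists_congr fun ε => and_congr_right fun hε => and_congr_right fun hxy => ?_
    rw [h (x + ε) (y - ε) hxy, h (x - ε) (y - ε) (by linarith), h (x + ε) (y + ε) (by linarith),
      h (x - ε) (y + ε) (by linarith)]
  have hi : ∀ k, infinityMult ℓ₁ k = infinityMult ℓ₂ k := fun k => by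
    unfold infinityMult
    congr 1
    ext n
    refine exists_congr fun ε => and_congr_right fun hε => and_congr_right fun hk => ?_
    rw [h (k + ε) (1 / ε) hk, h (k - ε) (1 / ε) (by linarith)]
  funext p
  cases p <;> simp only [mult, hp, hi]

theorem matchingDist_eq_zero_of_eq {ℓ₁ ℓ₂ : ℝ → ℝ → ℕ} (h : ∀ s t, s < t → ℓ₁ s t = ℓ₂ s t) :
    matchingDist ℓ₁ ℓ₂ = 0 := by
  let σ : Diagram ℓ₁ ≃ Diagram ℓ₂ := Equiv.sigmaCongrRight fun p =>
    Equiv.subtypeEquivRight fun n => by rw [mult_congr h]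
  refine le_antisymm (iInf_le_of_le σ (iSup_le fun c => ?_)) bot_le
  change pointCost c.1 c.1 ≤ 0
  cases c.1 <;> simp [pointCost]

/-! ### The foliation of `Δ⁺` -/

theorem sublevel_foliationFunction {X : Type*} {k : ℕ} (hk : 1 ≤ k) (φ : X → Fin k → ℝ)
    {l : Fin k → ℝ} (hl : ∀ i, 0 < l i) (b : Fin k → ℝ) (s : ℝ) :
    sublevel (foliationFunction φ l b) s = sublevel φ (fun i => s * l i + b i) := by
  have : Nonempty (Fin k) := ⟨⟨0, hk⟩⟩
  ext P
  refine (ciSup_le_iff (Set.finite_range fun i => (φ P i - b i) / l i).bddAbove).trans (forall_congr' fun i => ?_)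
  rw [div_le_iff₀ (hl i), sub_le_iff_le_add]

/-- Along each leaf of the foliation of `Δ⁺` the size function is a one-dimensional one. -/
theorem sizeFunction_foliationFunction {X : Type*} [TopologicalSpace X] {k : ℕ} (hk : 1 ≤ k)
    (φ : X → Fin k → ℝ) {l : Fin k → ℝ} (hl : ∀ i, 0 < l i) (b : Fin k → ℝ) (s t : ℝ) :
    sizeFunction (foliationFunction φ l b) s t =
      sizeFunction φ (fun i => s * l i + b i) (fun i => t * l i + b i) := by
  simp only [sizeFunction, levelClasses, LevelConnected, sublevel_foliationFunction hk φ hl b]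

theorem continuous_foliationFunction {X : Type*} [TopologicalSpace X] {k : ℕ} (hk : 1 ≤ k)
    {φ : X → Fin k → ℝ} (hφ : Continuous φ) (l b : Fin k → ℝ) :
    Continuous (foliationFunction φ l b) := by
  have : Nonempty (Fin k) := ⟨⟨0, hk⟩⟩
  have hne : (Finset.univ : Finset (Fin k)).Nonempty := Finset.univ_nonempty
  have : foliationFunction φ l b =
      fun P => Finset.univ.sup' hne fun i => (φ P i - b i) / l i := by
    funext P
    rw [Finset.sup'_univ_eq_ciSup]
    rfl
  rw [this]
  exact Continuous.finset_sup'_apply hne fun i _ => by fun_prop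

/-- Every point of `Δ⁺` lies on a leaf. -/
theorem exists_admissible {k : ℕ} (hk : 1 ≤ k) {x y : Fin k → ℝ} (hxy : ∀ i, x i < y i) :
    ∃ l b : Fin k → ℝ, ∃ s t : ℝ, Admissible l b ∧ s < t ∧ (fun i => s * l i + b i) = x ∧
      (fun i => t * l i + b i) = y := by
  have hne : (Finset.univ : Finset (Fin k)).Nonempty := ⟨⟨0, hk⟩, Finset.mem_univ _⟩
  -- Normalising `y - x` by its Euclidean norm `r` gives `l`, and `t = s + r`. The value of `s` is
  -- forced by the condition that the coordinates of `b = x - s l` sum to zero.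
  set r := √(∑ i, (y i - x i) ^ 2) with hr
  have hpos : 0 < ∑ i, (y i - x i) ^ 2 :=
    Finset.sum_pos (fun i _ => pow_pos (sub_pos.2 (hxy i)) 2) hne
  have hr0 : 0 < r := Real.sqrt_pos.2 hpos
  have hr2 : r ^ 2 = ∑ i, (y i - x i) ^ 2 := Real.sq_sqrt hpos.le
  set l : Fin k → ℝ := fun i => (y i - x i) / r with hl
  have hl0 : ∀ i, 0 < l i := fun i => div_pos (sub_pos.2 (hxy i)) hr0
  have hL : 0 < ∑ i, l i := Finset.sum_pos (fun i _ => hl0 i) hne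
  set s := (∑ i, x i) / ∑ i, l i with hs
  refine ⟨l, fun i => x i - s * l i, s, s + r, ⟨?_, hl0, ?_⟩, by linarith, ?_, ?_⟩
  · simp only [hl, div_pow]
    rw [← Finset.sum_div, ← hr2, div_self (by positivity)]
  · rw [Finset.sum_sub_distrib, ← Finset.mul_sum, hs, div_mul_cancel₀ _ hL.ne', sub_self]
  · funext i
    ring
  · funext i
    have : r * l i = y i - x i := mul_div_cancel₀ _ hr0.ne'
    linear_combination this

end SizeTheory

theorem mainTheorem4 {M : Type*} {N : Type*}
    [TopologicalSpace M] [Nonempty M] [CompactSpace M] [LocallyConnectedSpace M] [T2Space M]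
    [TopologicalSpace N] [Nonempty N] [CompactSpace N] [LocallyConnectedSpace N] [T2Space N]
    {k : ℕ} (hk : 1 ≤ k)
    (φ : M → Fin k → ℝ) (hφ : Continuous φ) (ψ : N → Fin k → ℝ) (hψ : Continuous ψ) :
    (∀ x y : Fin k → ℝ, (∀ i, x i < y i) →
        SizeTheory.sizeFunction φ x y = SizeTheory.sizeFunction ψ x y) ↔
      ∀ l b : Fin k → ℝ, SizeTheory.Admissible l b →
        SizeTheory.matchingDist
          (SizeTheory.sizeFunction (SizeTheory.foliationFunction φ l b))
          (SizeTheory.sizeFunction (SizeTheory.foliationFunction ψ l b)) = 0 := by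
  open SizeTheory in
  constructor
  · intro h l b hlb
    refine matchingDist_eq_zero_of_eq fun s t hst => ?_
    rw [sizeFunction_foliationFunction hk φ hlb.2.1, sizeFunction_foliationFunction hk ψ hlb.2.1]
    refine h _ _ fun i => ?_
    have := mul_lt_mul_of_pos_right hst (hlb.2.1 i)
    linarith
  · intro h x y hxy
    obtain ⟨l, b, s, t, hlb, hst, rfl, rfl⟩ := exists_admissible hk hxy
    rw [← sizeFunction_foliationFunction hk φ hlb.2.1, ← sizeFunction_foliationFunction hk ψ hlb.2.1]
    exact (rankFunction_sizeFunction (continuous_foliationFunction hk hφ l b)).eq_of_matchingDist_eq_zero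
      (rankFunction_sizeFunction (continuous_foliationFunction hk hψ l b)) (h l b hlb) hst
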